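/- Theorem 4.3. Let $A$ and $B$ be complex unital Banach algebras, and let $A\overline{\otimes}B$ be a Banach algebra which is the completion of the algebraic tensor product $A\otimes B$ with respect to a uniform crossnorm; that is, with respect to a submultiplicative norm $\|\cdot\|$ on $A\otimes B$ such that $\|a\otimes b\|=\|a\|\,\|b\|$ for all $a\in A$, $b\in B$, and $\|(S\otimes T)u\|\le\|S\|\,\|T\|\,\|u\|$ for all bounded linear operators $S\colon A\to A$ and $T\colon B\to B$ and all $u\in A\otimes B$. An element $x$ of a unital algebra is Drazin invertible if there are an element $y$ of the algebra and $m\in\mathbb N$ with $x^m y x=x^m$, $yxy=y$ and $xy=yx$. For an element $x$ of a complex unital Banach algebra let $\sigma(x)$ be its spectrum, let $\sigma_{DR}(x)=\{\lambda\in\mathbb C : x-\lambda \text{ is not Drazin invertible}\}$ be its Drazin spectrum, let $\rho_{DR}(x)=\mathbb C\setminus\sigma_{DR}(x)$, and let $\Pi(x)$ be the set of poles of $x$, that is, of those isolated points of $\sigma(x)$ at which the resolvent function $\lambda\mapsto(\lambda-x)^{-1}$ has a pole of some order $p\ge 1$. Let $a\in A$ and $b\in B$ be such that $\sigma_{DR}(a)\neq\emptyset$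 and $\sigma_{DR}(b)\neq\emptyset$, and put $\mathbb D=\sigma(a)\,\sigma_{DR}(b)\cup\sigma_{DR}(a)\,\sigma(b)$, where $KL=\{\mu\nu : \mu\in K,\ \nu\in L\}$ for $K, L\subseteq\mathbb C$. Then the following statements are equivalent: (i) $\mathbb D=\sigma_{DR}(a\otimes b)$, where $a\otimes b$ is regarded as an element of $A\overline{\otimes}B$; (ii) $a$ and $b$ are both invertible, or $a\otimes b$ is not Drazin invertible in $A\overline{\otimes}B$; (iii) $a$ and $b$ are both invertible, or $0\notin(\Pi(a)\cap\rho_{DR}(b))\cup(\rho_{DR}(a)\cap\Pi(b))$. -/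

import Mathlib

open scoped TensorProduct Pointwise

/-- `a` is Drazin invertible: there are `b` and `m` with `a ^ m b a = a ^ m`, `b a b = b` and
`a b = b a`. -/
def IsDrazinInvertible {R : Type*} [Ring R] (a : R) : Prop :=
  ∃ (b : R) (m : ℕ), a ^ m * b * a = a ^ m ∧ b * a * b = b ∧ a * b = b * a

/-- The Drazin spectrum of `a`: all `z` such that `a - z` is not Drazin invertible. -/
def drazinSpectrum {R : Type*} [Ring R] [Algebra ℂ R] (a : R) : Set ℂ :=
  {z | ¬ IsDrazinInvertible (a - algebraMap ℂ R z)}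

/-- The Drazin resolvent set of `a`: all `z` such that `a - z` is Drazin invertible. -/
def drazinResolventSet {R : Type*} [Ring R] [Algebra ℂ R] (a : R) : Set ℂ :=
  {z | IsDrazinInvertible (a - algebraMap ℂ R z)}

/-- The isolated points of a set `K` of complex numbers. -/
def isolatedPoints (K : Set ℂ) : Set ℂ :=
  {z | z ∈ K ∧ ¬ AccPt z (Filter.principal K)}

/-- The set of poles of `a`: the isolated points `z` of the spectrum of `a` at which the resolvent
function `w ↦ (w - a)⁻¹` has a pole of some order `p ≥ 1`. -/
def poleSet {A : Type*} [NormedRing A] [NormedAlgebra ℂ A] (a : A) : Set ℂ :=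
  {z | z ∈ isolatedPoints (spectrum ℂ a) ∧ MeromorphicAt (resolvent a : ℂ → A) z ∧
    ∃ p : ℕ, 1 ≤ p ∧ meromorphicOrderAt (resolvent a : ℂ → A) z = ((-(p : ℤ) : ℤ) : WithTop ℤ)}

/-- A uniform crossnorm on the algebraic tensor product `A ⊗ B`, which is moreover submultiplicative
(so that the completion of `A ⊗ B` is a Banach algebra): an algebra norm `α` on `A ⊗ B` with
`α (a ⊗ b) = ‖a‖ ‖b‖` for all `a`, `b`, and `α ((S ⊗ T) u) ≤ ‖S‖ ‖T‖ α u` for all bounded linear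
operators `S` on `A` and `T` on `B`. -/
structure UniformCrossnorm (A B : Type*) [NormedRing A] [NormedAlgebra ℂ A]
    [NormedRing B] [NormedAlgebra ℂ B] extends AlgebraNorm ℂ (A ⊗[ℂ] B) where
  tmul_eq' : ∀ (a : A) (b : B), toAlgebraNorm (a ⊗ₜ[ℂ] b) = ‖a‖ * ‖b‖
  map_le' : ∀ (S : A →L[ℂ] A) (T : B →L[ℂ] B) (u : A ⊗[ℂ] B),
    toAlgebraNorm (TensorProduct.map (S : A →ₗ[ℂ] A) (T : B →ₗ[ℂ] B) u)
      ≤ ‖S‖ * ‖T‖ * toAlgebraNorm u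

namespace UniformCrossnorm

variable {A B : Type*} [NormedRing A] [NormedAlgebra ℂ A] [NormedRing B] [NormedAlgebra ℂ B]

/-- The algebra `A ⊗ B`, as a type that carries the norm `α`. -/
def Normed (_α : UniformCrossnorm A B) : Type _ := A ⊗[ℂ] B

noncomputable instance (α : UniformCrossnorm A B) : NormedRing α.Normed :=
  RingNorm.toNormedRing (R := A ⊗[ℂ] B) α.toRingNorm

noncomputable instance (α : UniformCrossnorm A B) : NormedAlgebra ℂ α.Normed where
  __ := (inferInstance : Algebra ℂ (A ⊗[ℂ] B))
  norm_smul_le z u := le_of_eq (map_smul_eq_mul α.toAlgebraNorm z u)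

/-- The identity map of `A ⊗ B`, regarded as an isomorphism of algebras onto `α.Normed`. -/
noncomputable def toNormed (α : UniformCrossnorm A B) : A ⊗[ℂ] B ≃ₐ[ℂ] α.Normed :=
  AlgEquiv.refl (R := ℂ) (A₁ := A ⊗[ℂ] B)

/-- The completion of `A ⊗ B` with respect to the norm `α`. -/
abbrev Completion (α : UniformCrossnorm A B) : Type _ := UniformSpace.Completion α.Normed

noncomputable instance (α : UniformCrossnorm A B) : NormedAlgebra ℂ α.Completion where
  norm_smul_le := norm_smul_le

/-- The elementary tensor `a ⊗ b` in the completion of `A ⊗ B`. -/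
noncomputable def tmul (α : UniformCrossnorm A B) (a : A) (b : B) : α.Completion :=
  (α.toNormed (a ⊗ₜ[ℂ] b) : UniformSpace.Completion α.Normed)

end UniformCrossnorm

/-! ### Drazin invertibility in rings. -/

section DrazinAlgebra

variable {R S : Type*} [Ring R] [Ring S]

/-! Away from `0` the set `𝔻` and the Drazin spectrum of `a ⊗ b` always agree, so everything is
decided at `0`. There, `0 ∈ 𝔻` iff `a`, `b` are not both invertible, because both Drazin spectra are
nonempty; `a ⊗ b` is Drazin invertible iff `a` and `b` are, because neither is nilpotent; and `0` is
a pole of `a` iff `a` is Drazin invertible but not invertible (`zero_mem_poleSet_iff`). The rest is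
propositional.

Let `μ ν ≠ 0`, `μ ∈ σ(a)`, and let `a ⊗ b - μ ν` be Drazin invertible. If `μ` is a boundary point of
`σ(a)`, then `a - μ` has no one-sided inverse, and some functional `φ` with `φ 1 = 1` kills `A (a -
μ)`. The slice map `φ ⊗ id` turns right multiplication by `a ⊗ b - μ ν` into `μ` times right
multiplication by `b - ν`; with its mirror image it carries the relations `x ^ m ∈ E x ^ (m + 1) ∩ x
^ (m + 1) E` over to `b - ν`. If `μ` is interior, `mul_mem_spectrum` makes `μ ν` an accumulation
point of the spectrum, which Drazin invertibility forbids.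

Conversely, let `l ≠ 0` and let `a - μ`, `b - ν` be Drazin invertible for all spectral pairs with `μ
ν = l`. There are finitely many such pairs. In the bicommutant of `{a ⊗ 1, 1 ⊗ b}`, a commutative
Banach algebra, the sum of the products of the spectral idempotents serves as spectral idempotent of
`a ⊗ b - l`, as one sees on characters. -/

theorem pow_eq_pow_add_mul_pow {a c : R} {m : ℕ} (h : a ^ m = a ^ (m + 1) * c) (k : ℕ) :
    a ^ m = a ^ (m + k) * c ^ k := by
  induction k with
  | zero => simp
  | succ k ih =>
    calc a ^ m = a ^ k * a ^ m * c ^ k := by rw [← pow_add, add_comm k m]; exact ih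
      _ = a ^ k * (a ^ (m + 1) * c) * c ^ k := by rw [← h]
      _ = a ^ (m + (k + 1)) * c ^ (k + 1) := by
        rw [← mul_assoc, ← pow_add, mul_assoc _ c, ← pow_succ']
        congr 2
        omega

theorem pow_eq_pow_mul_pow_add {a d : R} {m : ℕ} (h : a ^ m = d * a ^ (m + 1)) (k : ℕ) :
    a ^ m = d ^ k * a ^ (m + k) := by
  induction k with
  | zero => simp
  | succ k ih =>
    calc a ^ m = d ^ k * (a ^ m * a ^ k) := by rw [← pow_add]; exact ih
      _ = d ^ k * (d * a ^ (m + 1) * a ^ k) := by rw [← h]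
      _ = d ^ (k + 1) * a ^ (m + (k + 1)) := by
        rw [mul_assoc d, ← pow_add, ← mul_assoc, ← pow_succ]
        congr 2
        omega

/-- A strongly `π`-regular element is Drazin invertible. -/
theorem IsDrazinInvertible.of_pow_eq {a c d : R} {m : ℕ} (hc : a ^ m = a ^ (m + 1) * c)
    (hd : a ^ m = d * a ^ (m + 1)) : IsDrazinInvertible a := by
  obtain ⟨C, hC⟩ : ∃ C, a ^ (m + 1) = a ^ (m + 1) * a ^ (m + 1) * C := by
    refine ⟨c ^ (m + 1), ?_⟩
    have := pow_eq_pow_add_mul_pow hc (m + 1)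
    calc a ^ (m + 1) = a * (a ^ (m + (m + 1)) * c ^ (m + 1)) := by rw [← this, pow_succ']
      _ = _ := by rw [← mul_assoc, ← pow_succ', ← pow_add]; congr 2; omega
  obtain ⟨D, hD⟩ : ∃ D, a ^ (m + 1) = D * (a ^ (m + 1) * a ^ (m + 1)) := by
    refine ⟨d ^ (m + 1), ?_⟩
    have := pow_eq_pow_mul_pow_add hd (m + 1)
    calc a ^ (m + 1) = d ^ (m + 1) * a ^ (m + (m + 1)) * a := by rw [← this, pow_succ]
      _ = _ := by rw [mul_assoc, ← pow_succ, ← pow_add]; congr 2; omega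
  have hag : a * a ^ (m + 1) = a ^ (m + 1) * a := (Commute.self_pow a (m + 1)).eq
  have hga : a ^ (m + 1) = a ^ m * a := pow_succ a m
  have hga' : a * a ^ m = a ^ (m + 1) := (pow_succ' a m).symm
  generalize a ^ (m + 1) = g at *
  have hDC : D * g = g * C := by
    calc D * g = D * (g * g * C) := by rw [← hC]
      _ = D * (g * g) * C := by noncomm_ring
      _ = g * C := by rw [← hD]
  -- `e = g C = D g` is a two-sided identity for `g = a ^ (m + 1)`. Then `y = D e = e C` is the
  -- inverse of `g` in the corner `e R e`, and `a ^ m y` is the Drazin inverse of `a`.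
  set e := g * C with he
  have hge : g * e = g := by rw [he, ← mul_assoc, ← hC]
  have heg : e * g = g := by rw [← hDC, mul_assoc, ← hD]
  have hee : e * e = e := by
    calc e * e = e * g * C := by rw [mul_assoc e g C]
      _ = e := by rw [heg]
  have hae : e * (a * e) = a * e := by
    calc e * (a * e) = e * (a * g) * C := by rw [he]; noncomm_ring
      _ = e * g * a * C := by rw [hag]; noncomm_ring
      _ = a * g * C := by rw [heg, hag]
      _ = a * e := by rw [he, mul_assoc]
  have hea : e * a * e = e * a := by
    calc e * a * e = D * (g * a) * e := by rw [← hDC]; noncomm_ring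
      _ = D * a * (g * e) := by rw [← hag]; noncomm_ring
      _ = D * (a * g) := by rw [hge, mul_assoc]
      _ = e * a := by rw [hag, ← mul_assoc, hDC]
  have hcomm : a * e = e * a := by rw [← hae, ← mul_assoc, hea]
  have hy : D * e = e * C := by rw [he, ← mul_assoc, hDC]
  have hgy : g * (D * e) = e := by rw [hy, ← mul_assoc, hge]
  have hyg : D * e * g = e := by rw [mul_assoc, heg, hDC]
  have hey : e * (D * e) = D * e := by rw [hy, ← mul_assoc, hee]
  have hye : D * e * e = D * e := by rw [mul_assoc, hee]
  generalize D * e = y at *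
  have hya : y * a = a * y := by
    calc y * a = y * (a * e) := by rw [hcomm, ← mul_assoc, hye]
      _ = y * (a * g) * y := by rw [← hgy]; noncomm_ring
      _ = y * g * a * y := by rw [hag]; noncomm_ring
      _ = a * (e * y) := by rw [hyg, ← hcomm, mul_assoc]
      _ = a * y := by rw [hey]
  have hyp : Commute y (a ^ m) := Commute.pow_right hya m
  have h1 : a * (a ^ m * y) = e := by rw [← mul_assoc, hga', hgy]
  have h2 : a ^ m * y * a = e := by rw [mul_assoc, hya, ← mul_assoc, ← hga, hgy]
  refine ⟨a ^ m * y, m + 1, ?_, ?_, ?_⟩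
  · have : a ^ (m + 1) = g := by rw [pow_succ, ← hga]
    rw [this, mul_assoc, h2, hge]
  · rw [h2, ← hyp.eq, ← mul_assoc, hey]
  · rw [h1, h2]

theorem IsDrazinInvertible.map {a : R} (h : IsDrazinInvertible a) (f : R →+* S) :
    IsDrazinInvertible (f a) := by
  obtain ⟨b, m, h1, h2, h3⟩ := h
  exact ⟨f b, m, by simp only [← map_pow, ← map_mul, h1], by simp only [← map_mul, h2],
    by simp only [← map_mul, h3]⟩

theorem IsUnit.isDrazinInvertible {a : R} (h : IsUnit a) : IsDrazinInvertible a := by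
  obtain ⟨u, rfl⟩ := h
  exact ⟨↑u⁻¹, 0, by simp, by simp, by simp⟩

theorem IsNilpotent.isDrazinInvertible {a : R} (h : IsNilpotent a) : IsDrazinInvertible a := by
  obtain ⟨m, hm⟩ := h
  exact ⟨0, m, by simp [hm], by simp, by simp⟩

theorem IsDrazinInvertible.exists_pow_eq {a : R} (h : IsDrazinInvertible a) :
    ∃ (y : R) (m : ℕ), Commute a y ∧ a ^ m = a ^ (m + 1) * y ∧ a ^ m = y * a ^ (m + 1) := by
  obtain ⟨y, m, h1, -, h3⟩ := h
  have hc : Commute a y := h3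
  have h : a ^ m = a ^ (m + 1) * y := by
    rw [pow_succ, mul_assoc, h3, ← mul_assoc, h1]
  exact ⟨y, m, hc, h, by rw [← (hc.pow_left (m + 1)).eq, ← h]⟩

theorem IsDrazinInvertible.map_mul_map {T : Type*} [Ring T] {i : R →+* T} {j : S →+* T}
    (hij : ∀ a b, Commute (i a) (j b)) {a : R} {b : S} (ha : IsDrazinInvertible a)
    (hb : IsDrazinInvertible b) : IsDrazinInvertible (i a * j b) := by
  obtain ⟨y, m, -, hy, hy'⟩ := ha.exists_pow_eq
  obtain ⟨z, n, -, hz, hz'⟩ := hb.exists_pow_eq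
  have key : ∀ k c d, (i a * j b) ^ k * (i c * j d) = i (a ^ k * c) * j (b ^ k * d) := by
    intro k c d
    rw [(hij a b).mul_pow, map_mul, map_mul, map_pow, map_pow, mul_assoc, mul_assoc,
      ← mul_assoc (j b ^ k), ← ((hij c b).pow_right k).eq, mul_assoc]
  have key' : ∀ k c d, (i c * j d) * (i a * j b) ^ k = i (c * a ^ k) * j (d * b ^ k) := by
    intro k c d
    rw [(hij a b).mul_pow, map_mul, map_mul, map_pow, map_pow, mul_assoc, mul_assoc,
      ← mul_assoc (j d), ← ((hij a d).pow_left k).eq, mul_assoc]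
  have h0 : (i a * j b) ^ (n + m) = i (a ^ (n + m)) * j (b ^ (n + m)) := by
    simpa using key (n + m) 1 1
  refine .of_pow_eq (m := n + m) (c := i y * j z) (d := i y * j z) ?_ ?_
  · rw [key, h0]
    congr 2
    · rw [pow_add, hy, add_assoc, pow_add _ n, mul_assoc]
    · rw [add_comm n m, pow_add, hz, add_assoc, pow_add _ m, mul_assoc]
  · rw [key', h0]
    congr 2
    · rw [add_comm n m, pow_add, hy', add_right_comm, pow_add _ (m + 1), mul_assoc]
    · rw [pow_add, hz', add_right_comm, pow_add _ (n + 1), mul_assoc]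

/-- With the spectral idempotent `p = 1 - a y`, one has `(a + p) (y + p) = 1 + a p`, and `a p` is
nilpotent. -/
theorem isUnit_add_one_sub_mul_of_isDrazin {a y : R} {m : ℕ} (hc : Commute a y) (hy : y * a * y = y)
    (hm : a ^ m * y * a = a ^ m) : IsUnit (a + (1 - a * y)) ∧ (a * (1 - a * y)) ^ (m + 1) = 0 := by
  have hp : (1 - a * y) * (1 - a * y) = 1 - a * y := by
    have : a * y * (a * y) = a * y := by rw [mul_assoc, ← mul_assoc y, hy]
    rw [sub_mul, one_mul, mul_sub, this, mul_one, sub_self, sub_zero]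
  have hap : Commute a (1 - a * y) :=
    (Commute.one_right a).sub_right ((Commute.refl a).mul_right hc)
  have hyp : y * (1 - a * y) = 0 := by rw [mul_sub, ← mul_assoc, hy, mul_one, sub_self]
  have hpy : (1 - a * y) * y = 0 := by rw [sub_mul, hc.eq, hy, one_mul, sub_self]
  have hnil : (a * (1 - a * y)) ^ (m + 1) = 0 := by
    have : (1 - a * y) ^ (m + 1) = 1 - a * y := IsIdempotentElem.pow_succ_eq m hp
    rw [hap.mul_pow, this, pow_succ', mul_assoc, mul_sub, mul_one, hc.eq, ← mul_assoc, hm, sub_self,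
      mul_zero]
  refine ⟨?_, hnil⟩
  have hu : IsUnit ((a + (1 - a * y)) * (y + (1 - a * y))) := by
    have : (a + (1 - a * y)) * (y + (1 - a * y)) = 1 + a * (1 - a * y) := by
      rw [add_mul, mul_add, mul_add, hp, hpy]; noncomm_ring
    rw [this]
    exact IsNilpotent.isUnit_one_add ⟨_, hnil⟩
  have hcm : Commute (a + (1 - a * y)) (y + (1 - a * y)) := by
    refine Commute.add_left (Commute.add_right hc hap) (Commute.add_right ?_ (Commute.refl _))
    rw [Commute, SemiconjBy, hyp, hpy]
  exact (hcm.isUnit_mul_iff.1 hu).1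

/-- An element which becomes invertible on adding a commuting element that it multiplies to a
nilpotent is Drazin invertible. -/
theorem IsDrazinInvertible.of_isUnit_add {z p : R} (hc : Commute z p) (hn : IsNilpotent (z * p))
    (hu : IsUnit (z + p)) : IsDrazinInvertible z := by
  obtain ⟨m, hm⟩ := hn
  obtain ⟨u, hu⟩ := hu
  have hzp : Commute z (z + p) := (Commute.refl z).add_right hc
  have hpp : Commute (z + p) p := hc.add_left (Commute.refl p)
  have hzu : Commute z (↑(u ^ m)⁻¹ : R) := by
    refine Commute.units_inv_right ?_
    rw [Units.val_pow_eq_pow_val, hu]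
    exact hzp.pow_right m
  set r := ∑ i ∈ Finset.range m, (z + p) ^ i * p ^ (m - 1 - i) with hr
  have hzr : Commute z r :=
    Commute.sum_right _ _ _ fun i _ => (hzp.pow_right _).mul_right (hc.pow_right _)
  -- Modulo `z`, the unit `(z + p) ^ m` equals `p ^ m`, and `z ^ m` kills `p ^ m`.
  have hum : ((u ^ m : Rˣ) : R) = z * r + p ^ m := by
    have := hpp.mul_geom_sum₂ m
    rw [add_sub_cancel_right] at this
    rw [hr, this, Units.val_pow_eq_pow_val, hu, sub_add_cancel]
  have h : z ^ m = z ^ (m + 1) * (r * ↑(u ^ m)⁻¹) := by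
    calc z ^ m = z ^ m * (↑(u ^ m) * ↑(u ^ m)⁻¹) := by rw [Units.mul_inv, mul_one]
      _ = (z ^ m * z * r + z ^ m * p ^ m) * ↑(u ^ m)⁻¹ := by rw [hum]; noncomm_ring
      _ = z ^ (m + 1) * (r * ↑(u ^ m)⁻¹) := by
        rw [← hc.mul_pow, hm, add_zero, ← pow_succ, mul_assoc]
  exact .of_pow_eq h (h.trans ((hzr.mul_right hzu).pow_left _).eq)

/-- The Drazin inverse commutes with everything that commutes with the element. -/
theorem commute_of_commute_of_isDrazin {a y e : R} {m : ℕ} (hc : Commute a y) (hy : y * a * y = y)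
    (hm : a ^ m * y * a = a ^ m) (he : Commute e a) : Commute e y := by
  have hid : (a * y) * (a * y) = a * y := by rw [mul_assoc, ← mul_assoc y, hy]
  have hf : a ^ (m + 1) * y ^ (m + 1) = a * y := by
    rw [← hc.mul_pow]; exact IsIdempotentElem.pow_succ_eq m hid
  have hf' : y ^ (m + 1) * a ^ (m + 1) = a * y := by
    rw [← hf]; exact ((hc.pow_pow _ _).eq).symm
  have hfa : a * y * a ^ (m + 1) = a ^ (m + 1) := by
    have hay : Commute (a * y) (a ^ m) := ((Commute.refl a).mul_left hc.symm).pow_right _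
    rw [pow_succ, ← mul_assoc, hay.eq, hc.eq, ← mul_assoc, hm]
  have haf : a ^ (m + 1) * (a * y) = a ^ (m + 1) := by
    have : Commute (a * y) (a ^ (m + 1)) :=
      ((Commute.refl a).mul_left hc.symm).pow_right _
    rw [← this.eq, hfa]
  have hep : Commute e (a ^ (m + 1)) := he.pow_right _
  -- The idempotent `a y` has the same range and kernel as `a ^ (m + 1)`; both are invariant under
  -- `e`, which gives the two halves of commutation.
  have h1 : e * (a * y) = a * y * (e * (a * y)) := by
    calc e * (a * y) = a ^ (m + 1) * e * y ^ (m + 1) := by rw [← hf, ← mul_assoc, hep.eq]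
      _ = a * y * (a ^ (m + 1) * e * y ^ (m + 1)) := by
        nth_rw 1 [← hfa]; simp only [mul_assoc]
      _ = a * y * (e * (a * y)) := by rw [← hep.eq, mul_assoc e, hf]
  have h2 : a * y * e = a * y * e * (a * y) := by
    calc a * y * e = y ^ (m + 1) * e * a ^ (m + 1) := by
          nth_rw 1 [← hf']; rw [mul_assoc, ← hep.eq, mul_assoc]
      _ = y ^ (m + 1) * e * a ^ (m + 1) * (a * y) := by
        nth_rw 1 [← haf]; simp only [mul_assoc]
      _ = a * y * e * (a * y) := by
        rw [mul_assoc (y ^ (m + 1)) e, hep.eq, ← mul_assoc (y ^ (m + 1)), hf']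
  have h3 : e * (a * y) = a * y * e := h1.trans ((mul_assoc _ _ _).symm.trans h2.symm)
  have hy' : a * y * y = y := by rw [hc.eq, hy]
  calc e * y = e * (a * y) * y := by rw [mul_assoc, hy']
    _ = y * (a * e) * y := by rw [h3, hc.eq, mul_assoc y]
    _ = y * (e * (a * y)) := by rw [← he.eq, mul_assoc, mul_assoc e]
    _ = y * a * y * e := by rw [h3]; simp only [mul_assoc]
    _ = y * e := by rw [hy]

/-- Converse to `IsDrazinInvertible.of_isUnit_add`, with an idempotent in the bicommutant of `a`, so
that it survives passage to a commutative subalgebra. -/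
theorem IsDrazinInvertible.exists_spectral_idempotent {a : R} (h : IsDrazinInvertible a) :
    ∃ e : R, e * e = e ∧ (∀ z, Commute z a → Commute z e) ∧ IsUnit (a + e) ∧
      IsNilpotent (a * e) := by
  obtain ⟨y, m, h1, h2, h3⟩ := h
  obtain ⟨hu, hn⟩ := isUnit_add_one_sub_mul_of_isDrazin h3 h2 h1
  refine ⟨1 - a * y, ?_, fun z hz => ?_, hu, _, hn⟩
  · have : a * y * (a * y) = a * y := by rw [mul_assoc, ← mul_assoc y, h2]
    rw [sub_mul, one_mul, mul_sub, this, mul_one, sub_self, sub_zero]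
  · exact (Commute.one_right z).sub_right
      (hz.mul_right (commute_of_commute_of_isDrazin h3 h2 h1 hz))

end DrazinAlgebra

/-! ### Drazin invertibility and poles of the resolvent. -/

section Poles

open Filter Topology

variable {A : Type*} [NormedRing A] [NormedAlgebra ℂ A]

theorem analyticAt_algebraMap (z : ℂ) : AnalyticAt ℂ (algebraMap ℂ A) z :=
  (algebraMapCLM ℂ A).analyticAt z

theorem AnalyticAt.exists_eq_add_smul {E : Type*} [NormedAddCommGroup E] [NormedSpace ℂ E]
    {k : ℂ → E} (hk : AnalyticAt ℂ k 0) : ∃ h : ℂ → E, AnalyticAt ℂ h 0 ∧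
      ∀ w, k w = k 0 + w • h w := by
  obtain ⟨p, hp⟩ := hk
  refine ⟨dslope k 0, ⟨_, hp.has_fpower_series_dslope_fslope⟩, fun w => ?_⟩
  have := sub_smul_dslope k 0 w
  rw [sub_zero] at this
  rw [this, add_sub_cancel]

theorem eq_at_zero_of_eventually_nhdsNE {X : Type*} [TopologicalSpace X] [T2Space X]
    {F : ℂ → X} {d : X} (hF : ContinuousAt F 0)
    (h : ∀ᶠ w in 𝓝[≠] (0 : ℂ), F w = d) : F 0 = d :=
  tendsto_nhds_unique (hF.mono_left nhdsWithin_le_nhds)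
    ((tendsto_congr' h).2 tendsto_const_nhds)

/-- Letting `w → 0` gives `d = -a k(0)`. Writing `k = k(0) + w g` and dividing by `w` gives `(w - a)
g = -k(0)`, the same situation one power lower. -/
theorem exists_eq_pow_mul_of_analyticAt (a : A) (n : ℕ) {d : A} {k : ℂ → A}
    (hk : AnalyticAt ℂ k 0)
    (h : ∀ᶠ w in 𝓝[≠] (0 : ℂ), (algebraMap ℂ A w - a) * k w = d) : ∃ c, d = a ^ n * c := by
  induction n generalizing d k with
  | zero => exact ⟨d, by simp⟩
  | succ n ih =>
    have h0 := eq_at_zero_of_eventually_nhdsNE (F := fun w => (algebraMap ℂ A w - a) * k w)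
      (((analyticAt_algebraMap 0).sub analyticAt_const).mul hk).continuousAt h
    simp only [map_zero, zero_sub, neg_mul] at h0
    obtain ⟨g, hg, hkg⟩ := hk.exists_eq_add_smul
    have h1 : ∀ᶠ w in 𝓝[≠] (0 : ℂ), (algebraMap ℂ A w - a) * g w = -k 0 := by
      filter_upwards [h, self_mem_nhdsWithin] with w hw hw0
      rw [hkg w, mul_add, mul_smul_comm, sub_mul, ← h0, ← Algebra.smul_def] at hw
      refine smul_right_injective A hw0 ?_
      simp only
      linear_combination (norm := module) hw
    obtain ⟨c, hc⟩ := ih hg h1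
    exact ⟨c, by rw [← h0, pow_succ', mul_assoc, ← hc]; simp⟩

theorem exists_eq_mul_pow_of_analyticAt (a : A) (n : ℕ) {d : A} {k : ℂ → A}
    (hk : AnalyticAt ℂ k 0)
    (h : ∀ᶠ w in 𝓝[≠] (0 : ℂ), k w * (algebraMap ℂ A w - a) = d) : ∃ c, d = c * a ^ n := by
  induction n generalizing d k with
  | zero => exact ⟨d, by simp⟩
  | succ n ih =>
    have h0 := eq_at_zero_of_eventually_nhdsNE (F := fun w => k w * (algebraMap ℂ A w - a))
      (hk.mul ((analyticAt_algebraMap 0).sub analyticAt_const)).continuousAt h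
    simp only [map_zero, zero_sub, mul_neg] at h0
    obtain ⟨g, hg, hkg⟩ := hk.exists_eq_add_smul
    have h1 : ∀ᶠ w in 𝓝[≠] (0 : ℂ), g w * (algebraMap ℂ A w - a) = -k 0 := by
      filter_upwards [h, self_mem_nhdsWithin] with w hw hw0
      rw [hkg w, add_mul, smul_mul_assoc, mul_sub, ← h0, ← Algebra.commutes,
        ← Algebra.smul_def] at hw
      refine smul_right_injective A hw0 ?_
      simp only
      linear_combination (norm := module) hw
    obtain ⟨c, hc⟩ := ih hg h1
    exact ⟨c, by rw [← h0, pow_succ, ← mul_assoc, ← hc]; simp⟩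

/-- This is the Laurent expansion of the resolvent multiplied by `W ^ m`: a finite geometric sum on
the nilpotent part `p`, and `-y (1 - W y)⁻¹` on the invertible part. -/
theorem mul_eq_pow_of_isDrazin {R : Type*} [Ring R] {a y p u W : R} {m : ℕ} (hp : p = 1 - a * y)
    (hap : a ^ m * p = 0) (hyp : p * y = 0) (hWa : Commute W a) (hWp : Commute W p)
    (hu : (1 - W * y) * u = 1) :
    (W - a) * ((∑ i ∈ Finset.range m, W ^ i * a ^ (m - 1 - i)) * p - W ^ m * (y * u)) = W ^ m := by
  have hpu : p * u = p := by
    calc p * u = (p * (1 - W * y)) * u := by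
          rw [mul_sub, ← mul_assoc, ← hWp.eq, mul_assoc W, hyp, mul_zero, sub_zero, mul_one]
      _ = p := by rw [mul_assoc, hu, mul_one]
  have h1 : (W - a) * y = p - (1 - W * y) := by rw [hp]; noncomm_ring
  have h2 : Commute (W - a) (W ^ m) :=
    ((Commute.refl W).sub_left hWa.symm).pow_right m
  rw [mul_sub, ← mul_assoc, hWa.mul_geom_sum₂, ← mul_assoc, h2.eq, mul_assoc, ← mul_assoc _ y,
    h1, sub_mul p, hpu, hu, sub_mul, hap]
  noncomm_ring

theorem IsDrazinInvertible.exists_analyticAt_resolvent [CompleteSpace A] {a : A}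
    (h : IsDrazinInvertible a) : ∃ (m : ℕ) (G : ℂ → A), AnalyticAt ℂ G 0 ∧
      ∀ᶠ w in 𝓝 (0 : ℂ), (algebraMap ℂ A w - a) * G w = algebraMap ℂ A (w ^ m) ∧
        G w * (algebraMap ℂ A w - a) = algebraMap ℂ A (w ^ m) := by
  obtain ⟨y, m, h1, h2, h3⟩ := h
  have hc : Commute a y := h3
  have hap : a ^ m * (1 - a * y) = 0 := by rw [h3, mul_sub, mul_one, ← mul_assoc, h1, sub_self]
  have hpy : (1 - a * y) * y = 0 := by rw [h3, sub_mul, one_mul, h2, sub_self]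
  have hcp : Commute a (1 - a * y) :=
    (Commute.one_right a).sub_right ((Commute.refl a).mul_right hc)
  set u : ℂ → A := fun w => Ring.inverse (1 - algebraMap ℂ A w * y) with hu
  have ht : AnalyticAt ℂ (fun w => 1 - algebraMap ℂ A w * y) 0 :=
    analyticAt_const.sub ((analyticAt_algebraMap 0).mul analyticAt_const)
  have hu' : ∀ᶠ w in 𝓝 (0 : ℂ), IsUnit (1 - algebraMap ℂ A w * y) :=
    ht.continuousAt.eventually (Units.isOpen.mem_nhds (by simp))
  have hua : AnalyticAt ℂ u 0 := by
    refine AnalyticAt.fun_comp (g := Ring.inverse) ?_ ht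
    simpa using analyticAt_inverse (𝕜 := ℂ) (1 : Aˣ)
  refine ⟨m, fun w => (∑ i ∈ Finset.range m, algebraMap ℂ A w ^ i * a ^ (m - 1 - i)) *
    (1 - a * y) - algebraMap ℂ A w ^ m * (y * u w), ?_, ?_⟩
  · refine AnalyticAt.sub (AnalyticAt.mul (Finset.analyticAt_fun_sum _ fun i _ => ?_)
      analyticAt_const) (((analyticAt_algebraMap 0).pow m).mul (analyticAt_const.mul hua))
    exact ((analyticAt_algebraMap 0).pow i).mul analyticAt_const
  · filter_upwards [hu'] with w hw
    have key := mul_eq_pow_of_isDrazin (m := m) (u := u w) rfl hap hpy (Algebra.commutes w a)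
      (Algebra.commutes w (1 - a * y)) (Ring.mul_inverse_cancel _ hw)
    refine ⟨by rw [key, map_pow], ?_⟩
    rw [map_pow]
    refine Eq.trans (Commute.eq ?_) key
    have hW : ∀ z, Commute (algebraMap ℂ A w) z := Algebra.commutes w
    have hau : Commute a (u w) := by
      obtain ⟨v, hv⟩ := hw
      rw [show u w = Ring.inverse (1 - algebraMap ℂ A w * y) from rfl, ← hv, Ring.inverse_unit]
      refine Commute.units_inv_right ?_
      rw [hv]
      exact (Commute.one_right a).sub_right (((hW a).symm).mul_right hc)
    refine Commute.sub_left (Commute.mul_left (Commute.sum_left _ _ _ fun i _ => ?_) ?_) ?_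
    · exact (((hW _).pow_left i)).mul_left (((hW a).symm.sub_right (Commute.refl a)).pow_left _)
    · exact (hW _).symm.sub_right hcp.symm
    · exact ((hW _).pow_left m).mul_left
        ((hW _).symm.sub_right (hc.mul_right hau).symm)

theorem IsDrazinInvertible.eventually_notMem_spectrum_zero [CompleteSpace A] {a : A}
    (h : IsDrazinInvertible a) : ∀ᶠ w in 𝓝[≠] (0 : ℂ), w ∉ spectrum ℂ a := by
  obtain ⟨m, G, -, hG⟩ := h.exists_analyticAt_resolvent
  filter_upwards [hG.filter_mono nhdsWithin_le_nhds, self_mem_nhdsWithin] with w hw hw0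
  rw [spectrum.notMem_iff]
  have hu : IsUnit (algebraMap ℂ A (w ^ m)) := (IsUnit.mk0 _ (pow_ne_zero m hw0)).map _
  have hc : Commute (algebraMap ℂ A w - a) (G w) := hw.1.trans hw.2.symm
  rw [← hw.1, hc.isUnit_mul_iff] at hu
  exact hu.1

theorem IsDrazinInvertible.eventually_notMem_spectrum [CompleteSpace A] {a : A} {μ : ℂ}
    (h : IsDrazinInvertible (a - algebraMap ℂ A μ)) : ∀ᶠ z in 𝓝[≠] μ, z ∉ spectrum ℂ a := by
  have h0 := h.eventually_notMem_spectrum_zero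
  rw [eventually_nhdsWithin_iff] at h0 ⊢
  have ht : Tendsto (fun z : ℂ => z - μ) (𝓝 μ) (𝓝 0) := by
    have : Continuous (fun z : ℂ => z - μ) := by fun_prop
    simpa using this.tendsto μ
  filter_upwards [ht.eventually h0] with z hz hzμ
  have := hz (sub_ne_zero.2 hzμ)
  rw [spectrum.notMem_iff] at this ⊢
  rwa [map_sub, sub_sub_sub_cancel_right] at this

theorem zero_mem_poleSet_iff [CompleteSpace A] {a : A} :
    (0 : ℂ) ∈ poleSet a ↔ IsDrazinInvertible a ∧ ¬ IsUnit a := by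
  constructor
  · rintro ⟨⟨h0, hacc⟩, hmer, p, -, hp⟩
    rw [spectrum.zero_mem_iff] at h0
    refine ⟨?_, h0⟩
    obtain ⟨g, hg, -, hgr⟩ := (meromorphicOrderAt_eq_int_iff hmer).1 hp
    have hn : ∀ᶠ w in 𝓝[≠] (0 : ℂ), w ∉ spectrum ℂ a := by
      rw [accPt_iff_frequently, not_frequently] at hacc
      rw [eventually_nhdsWithin_iff]
      filter_upwards [hacc] with w hw hw0 hws
      exact hw ⟨hw0, hws⟩
    have hres : ∀ᶠ w in 𝓝[≠] (0 : ℂ), g w = w ^ p • resolvent a w ∧ w ∉ spectrum ℂ a := by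
      filter_upwards [hgr, hn, self_mem_nhdsWithin] with w hw hws hw0
      refine ⟨?_, hws⟩
      rw [hw, sub_zero, smul_smul, zpow_neg, zpow_natCast, mul_inv_cancel₀ (pow_ne_zero p hw0),
        one_smul]
    have hQ : AnalyticAt ℂ
        (fun w => ∑ i ∈ Finset.range p, algebraMap ℂ A w ^ i * a ^ (p - 1 - i)) 0 :=
      Finset.analyticAt_fun_sum _ fun i _ =>
        ((analyticAt_algebraMap 0).pow i).mul analyticAt_const
    have hW : ∀ w z, Commute (algebraMap ℂ A w) z := Algebra.commutes
    -- With `g = w ^ p (w - a)⁻¹` and `Q` the geometric sum, `(w - a) (g - Q) = w ^ p - (w ^ p - a ^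
    -- p) = a ^ p`, so `a ^ p` is divisible by every power of `a`; the power `p + 1` is enough.
    obtain ⟨c, hc⟩ := exists_eq_pow_mul_of_analyticAt a (p + 1) (d := a ^ p) (hg.sub hQ) (by
      filter_upwards [hres] with w hw
      rw [Pi.sub_apply, mul_sub, (hW w a).mul_geom_sum₂, hw.1, mul_smul_comm, resolvent,
        Ring.mul_inverse_cancel _ (spectrum.notMem_iff.1 hw.2), ← map_pow,
        Algebra.algebraMap_eq_smul_one, sub_sub_cancel])
    obtain ⟨d, hd⟩ := exists_eq_mul_pow_of_analyticAt a (p + 1) (d := a ^ p) (hg.sub hQ) (by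
      filter_upwards [hres] with w hw
      rw [Pi.sub_apply, sub_mul, (hW w a).geom_sum₂_mul, hw.1, smul_mul_assoc, resolvent,
        Ring.inverse_mul_cancel _ (spectrum.notMem_iff.1 hw.2), ← map_pow,
        Algebra.algebraMap_eq_smul_one, sub_sub_cancel])
    exact .of_pow_eq hc hd
  · rintro ⟨h, hu⟩
    have hA : Nontrivial A := by
      by_contra hA
      rw [not_nontrivial_iff_subsingleton] at hA
      exact hu (isUnit_of_subsingleton a)
    have hn := h.eventually_notMem_spectrum_zero
    obtain ⟨m, G, hG, hGw⟩ := h.exists_analyticAt_resolvent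
    have hres : ∀ᶠ w in 𝓝[≠] (0 : ℂ), resolvent a w = (w ^ m)⁻¹ • G w := by
      filter_upwards [hGw.filter_mono nhdsWithin_le_nhds, hn, self_mem_nhdsWithin] with w hw hws hw0
      have hu := spectrum.notMem_iff.1 hws
      rw [eq_inv_smul_iff₀ (pow_ne_zero m hw0), resolvent, Algebra.smul_def, ← hw.2, mul_assoc,
        Ring.mul_inverse_cancel _ hu, mul_one]
    have hmer : MeromorphicAt (resolvent a : ℂ → A) 0 := by
      have : MeromorphicAt (fun w : ℂ => (w ^ m)⁻¹ • G w) 0 :=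
        MeromorphicAt.smul ((analyticAt_id.pow m).meromorphicAt.inv) hG.meromorphicAt
      refine this.congr ?_
      filter_upwards [hres] with w hw using hw.symm
    refine ⟨⟨(spectrum.zero_mem_iff ℂ).2 hu, ?_⟩, hmer, ?_⟩
    · rw [accPt_iff_frequently, not_frequently]
      rw [eventually_nhdsWithin_iff] at hn
      filter_upwards [hn] with w hw hw'
      exact hw hw'.1 hw'.2
    · have hinv : ∀ᶠ w in 𝓝[≠] (0 : ℂ), (algebraMap ℂ A w - a) * resolvent a w = 1 ∧
          resolvent a w * (algebraMap ℂ A w - a) = 1 := by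
        filter_upwards [hn] with w hw
        have hu := spectrum.notMem_iff.1 hw
        exact ⟨Ring.mul_inverse_cancel _ hu, Ring.inverse_mul_cancel _ hu⟩
      -- Otherwise the resolvent would converge at `0`, and its limit would invert `-a`.
      have hneg : meromorphicOrderAt (resolvent a : ℂ → A) 0 < 0 := by
        by_contra hlt
        obtain ⟨c, hc⟩ := tendsto_nhds_of_meromorphicOrderAt_nonneg hmer (not_lt.1 hlt)
        have ht : Tendsto (fun w : ℂ => algebraMap ℂ A w - a) (𝓝[≠] 0) (𝓝 (0 - a)) := by
          have := ((analyticAt_algebraMap (A := A) 0).continuousAt.tendsto.mono_left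
            (nhdsWithin_le_nhds (s := {0}ᶜ))).sub_const a
          rwa [map_zero] at this
        have h1 : (0 - a) * c = 1 := tendsto_nhds_unique (ht.mul hc)
          ((tendsto_congr' (hinv.mono fun _ h => h.1)).2 tendsto_const_nhds)
        have h2 : c * (0 - a) = 1 := tendsto_nhds_unique (hc.mul ht)
          ((tendsto_congr' (hinv.mono fun _ h => h.2)).2 tendsto_const_nhds)
        exact hu ⟨⟨a, -c, by rw [mul_neg, ← h1]; noncomm_ring, by rw [neg_mul, ← h2]; noncomm_ring⟩,
          rfl⟩
      lift meromorphicOrderAt (resolvent a : ℂ → A) 0 to ℤ using hneg.ne_top with n hn'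
      have hn0 : n < 0 := by exact_mod_cast hneg
      refine ⟨n.natAbs, by omega, ?_⟩
      congr 1
      omega

end Poles

/-! ### One-sided inverses, annihilating functionals and boundary spectrum. -/

section OneSidedInverses

variable {A : Type*} [NormedRing A] [NormedAlgebra ℂ A] [CompleteSpace A]

theorem Submodule.exists_dual_eq_one_of_notMem_closure {E : Type*} [NormedAddCommGroup E]
    [NormedSpace ℂ E] (M : Submodule ℂ E) {x : E} (hx : x ∉ closure (M : Set E)) :
    ∃ φ : E →L[ℂ] ℂ, φ x = 1 ∧ ∀ y ∈ M, φ y = 0 := by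
  have : IsClosed (M.topologicalClosure : Set E) := M.isClosed_topologicalClosure
  have hx' : M.topologicalClosure.mkQ x ≠ 0 := by
    rw [Submodule.mkQ_apply, Ne, Submodule.Quotient.mk_eq_zero]
    exact hx
  obtain ⟨f, hf⟩ := SeparatingDual.exists_eq_one (R := ℂ) hx'
  refine ⟨f.comp M.topologicalClosure.mkQL, hf, fun y hy => ?_⟩
  have : M.topologicalClosure.mkQ y = 0 := by
    rw [Submodule.mkQ_apply, Submodule.Quotient.mk_eq_zero]
    exact M.le_topologicalClosure hy
  change f (M.topologicalClosure.mkQ y) = 0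
  rw [this, map_zero]

omit [NormedAlgebra ℂ A] in
theorem isUnit_of_norm_sub_one_lt_one {u : A} (h : ‖u - 1‖ < 1) : IsUnit u := by
  have := isUnit_one_sub_of_norm_lt_one (x := 1 - u) (by rwa [norm_sub_rev])
  rwa [sub_sub_cancel] at this

/-- An element without left inverse is annihilated on the left by a functional. -/
theorem exists_dual_mul_right_eq_zero {t : A} (ht : ¬ ∃ c, c * t = 1) :
    ∃ φ : A →L[ℂ] ℂ, φ 1 = 1 ∧ ∀ c, φ (c * t) = 0 := by
  -- The left ideal `A t` stays at distance at least `1` from `1`: a closer element would be a unit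
  -- and yield a left inverse of `t`.
  obtain ⟨φ, h1, h2⟩ := Submodule.exists_dual_eq_one_of_notMem_closure
    (LinearMap.range (LinearMap.mulRight ℂ t)) (x := 1) (fun h => by
      obtain ⟨_, ⟨c, rfl⟩, hc⟩ := Metric.mem_closure_iff.1 h 1 one_pos
      rw [dist_comm, dist_eq_norm] at hc
      obtain ⟨u, hu⟩ := isUnit_of_norm_sub_one_lt_one hc
      refine ht ⟨↑u⁻¹ * c, ?_⟩
      rw [mul_assoc, show c * t = u from hu.symm, Units.inv_mul])
  exact ⟨φ, h1, fun c => h2 _ ⟨c, rfl⟩⟩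

/-- An element without right inverse is annihilated on the right by a functional. -/
theorem exists_dual_mul_left_eq_zero {t : A} (ht : ¬ ∃ c, t * c = 1) :
    ∃ φ : A →L[ℂ] ℂ, φ 1 = 1 ∧ ∀ c, φ (t * c) = 0 := by
  obtain ⟨φ, h1, h2⟩ := Submodule.exists_dual_eq_one_of_notMem_closure
    (LinearMap.range (LinearMap.mulLeft ℂ t)) (x := 1) (fun h => by
      obtain ⟨_, ⟨c, rfl⟩, hc⟩ := Metric.mem_closure_iff.1 h 1 one_pos
      rw [dist_comm, dist_eq_norm] at hc
      obtain ⟨u, hu⟩ := isUnit_of_norm_sub_one_lt_one hc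
      refine ht ⟨c * ↑u⁻¹, ?_⟩
      rw [← mul_assoc, show t * c = u from hu.symm, Units.mul_inv])
  exact ⟨φ, h1, fun c => h2 _ ⟨c, rfl⟩⟩

omit [NormedAlgebra ℂ A] in
/-- A non-invertible limit of invertible elements is not one-sided invertible. -/
theorem not_exists_inverse_of_mem_closure {t : A} (ht : ¬ IsUnit t)
    (h : t ∈ closure {u : A | IsUnit u}) : (¬ ∃ c, c * t = 1) ∧ ¬ ∃ c, t * c = 1 := by
  constructor
  · rintro ⟨c, hc⟩
    -- Since `c s` is a unit for `s` near `t`, an invertible such `s` forces `c`, and hence `t`, to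
    -- be invertible.
    have ho : IsOpen {s : A | IsUnit (c * s)} :=
      Units.isOpen.preimage (continuous_const.mul continuous_id)
    obtain ⟨s, hs, hsu⟩ := mem_closure_iff.1 h _ ho (by simp [hc])
    have hcu : IsUnit c := (Units.isUnit_mul_units c hsu.unit).1 hs
    exact ht ((hcu.unit.isUnit_units_mul t).1 (by simp [hc]))
  · rintro ⟨c, hc⟩
    have ho : IsOpen {s : A | IsUnit (s * c)} :=
      Units.isOpen.preimage (continuous_id.mul continuous_const)
    obtain ⟨s, hs, hsu⟩ := mem_closure_iff.1 h _ ho (by simp [hc])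
    have hcu : IsUnit c := (hsu.unit.isUnit_units_mul c).1 hs
    exact ht ((Units.isUnit_mul_units t hcu.unit).1 (by simp [hc]))

theorem not_exists_inverse_of_mem_frontier_spectrum {a : A} {μ : ℂ}
    (hμ : μ ∈ spectrum ℂ a) (h : μ ∉ interior (spectrum ℂ a)) :
    (¬ ∃ c, c * (a - algebraMap ℂ A μ) = 1) ∧ ¬ ∃ c, (a - algebraMap ℂ A μ) * c = 1 := by
  refine not_exists_inverse_of_mem_closure (fun hu => ?_) ?_
  · rw [spectrum.mem_iff] at hμ
    exact hμ (by rw [← neg_sub]; exact hu.neg)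
  · have hc : μ ∈ closure (spectrum ℂ a)ᶜ := by rwa [closure_compl]
    have hcont : Continuous fun z : ℂ => a - algebraMap ℂ A z :=
      continuous_const.sub (algebraMapCLM ℂ A).continuous
    refine closure_mono ?_ (image_closure_subset_closure_image hcont ⟨μ, hc, rfl⟩)
    rintro _ ⟨z, hz, rfl⟩
    have : IsUnit (algebraMap ℂ A z - a) := spectrum.notMem_iff.1 hz
    rw [← neg_sub] at this
    exact (IsUnit.neg_iff _).1 this

theorem isUnit_sub_algebraMap_iff {R : Type*} [Ring R] [Algebra ℂ R] {a : R} {z : ℂ} :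
    IsUnit (a - algebraMap ℂ R z) ↔ z ∉ spectrum ℂ a := by
  rw [spectrum.notMem_iff, ← IsUnit.neg_iff, neg_sub]

end OneSidedInverses

/-! ### Slice maps and the spectrum of `a ⊗ b`. -/

section SlicedProduct

open Filter Topology

variable {A B E : Type*} [NormedRing A] [NormedAlgebra ℂ A]
  [NormedRing B] [NormedAlgebra ℂ B] [NormedRing E] [NormedAlgebra ℂ E]

/-- `E` is topologically generated by commuting copies of `A` and `B`, in the manner of a completed
tensor product: every bounded functional on one factor induces a bounded slice map onto the
other. -/
structure SlicedProduct (i : A →ₐ[ℂ] E) (j : B →ₐ[ℂ] E) : Prop where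
  commute : ∀ a b, Commute (i a) (j b)
  dense : Dense (Submodule.span ℂ {u : E | ∃ a b, u = i a * j b} : Set E)
  slice_left : ∀ φ : A →L[ℂ] ℂ, ∃ S : E →L[ℂ] B, ∀ a b, S (i a * j b) = φ a • b
  slice_right : ∀ ψ : B →L[ℂ] ℂ, ∃ S : E →L[ℂ] A, ∀ a b, S (i a * j b) = ψ b • a

namespace SlicedProduct

variable {i : A →ₐ[ℂ] E} {j : B →ₐ[ℂ] E}

theorem symm (h : SlicedProduct i j) : SlicedProduct j i where
  commute b a := (h.commute a b).symm
  dense := by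
    convert h.dense using 3
    ext u
    exact ⟨fun ⟨b, a, hu⟩ => ⟨a, b, hu.trans (h.commute a b).symm⟩,
      fun ⟨a, b, hu⟩ => ⟨b, a, hu.trans (h.commute a b)⟩⟩
  slice_left ψ := (h.slice_right ψ).imp fun S hS b a => by rw [← (h.commute a b).eq, hS]
  slice_right φ := (h.slice_left φ).imp fun S hS b a => by rw [← (h.commute a b).eq, hS]

theorem ext_clm (h : SlicedProduct i j) {F : Type*} [NormedAddCommGroup F] [NormedSpace ℂ F]
    {S T : E →L[ℂ] F} (hST : ∀ a b, S (i a * j b) = T (i a * j b)) (u : E) : S u = T u := by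
  have : S = T := ContinuousLinearMap.ext_on h.dense (by rintro _ ⟨a, b, rfl⟩; exact hST a b)
  rw [this]

/-- The hypothesis on `φ` says `φ (c a) = μ φ(c)`. Hence the identity holds on elementary tensors,
and density extends it. -/
theorem slice_mul_sub (h : SlicedProduct i j) {φ : A →L[ℂ] ℂ} {S : E →L[ℂ] B}
    (hS : ∀ a b, S (i a * j b) = φ a • b) {a : A} {b : B} {μ ν : ℂ}
    (hφ : ∀ c, φ (c * (a - algebraMap ℂ A μ)) = 0) (u : E) :
    S (u * (i a * j b - algebraMap ℂ E (μ * ν))) = μ • (S u * (b - algebraMap ℂ B ν)) := by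
  refine h.ext_clm (S := S.comp ((ContinuousLinearMap.mul ℂ E).flip
    (i a * j b - algebraMap ℂ E (μ * ν)))) (T := μ • ((ContinuousLinearMap.mul ℂ B).flip
    (b - algebraMap ℂ B ν)).comp S) (fun c d => ?_) u
  have hc : φ (c * a) = μ * φ c := by
    have := hφ c
    rw [mul_sub, ← Algebra.commutes, ← Algebra.smul_def, map_sub, map_smul, sub_eq_zero] at this
    exact this
  have : i c * j d * (i a * j b) = i (c * a) * j (d * b) := by
    rw [map_mul, map_mul, mul_assoc, ← mul_assoc (j d), ← (h.commute a d).eq, mul_assoc, mul_assoc]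
  simp only [ContinuousLinearMap.comp_apply, ContinuousLinearMap.flip_apply,
    ContinuousLinearMap.mul_apply', smul_apply]
  rw [mul_sub, this, ← Algebra.commutes, ← Algebra.smul_def, map_sub, map_smul, hS, hS, hc,
    mul_sub, ← Algebra.commutes, ← Algebra.smul_def, smul_mul_assoc]
  module

theorem slice_sub_mul (h : SlicedProduct i j) {φ : A →L[ℂ] ℂ} {S : E →L[ℂ] B}
    (hS : ∀ a b, S (i a * j b) = φ a • b) {a : A} {b : B} {μ ν : ℂ}
    (hφ : ∀ c, φ ((a - algebraMap ℂ A μ) * c) = 0) (u : E) :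
    S ((i a * j b - algebraMap ℂ E (μ * ν)) * u) = μ • ((b - algebraMap ℂ B ν) * S u) := by
  refine h.ext_clm (S := S.comp (ContinuousLinearMap.mul ℂ E
    (i a * j b - algebraMap ℂ E (μ * ν)))) (T := μ • (ContinuousLinearMap.mul ℂ B
    (b - algebraMap ℂ B ν)).comp S) (fun c d => ?_) u
  have hc : φ (a * c) = μ * φ c := by
    have := hφ c
    rw [sub_mul, ← Algebra.smul_def, map_sub, map_smul, sub_eq_zero] at this
    exact this
  have : (i a * j b) * (i c * j d) = i (a * c) * j (b * d) := by
    rw [map_mul, map_mul, mul_assoc, ← mul_assoc (j b), ← (h.commute c b).eq, mul_assoc, mul_assoc]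
  simp only [ContinuousLinearMap.comp_apply,
    ContinuousLinearMap.mul_apply', smul_apply]
  rw [sub_mul, this, ← Algebra.smul_def, map_sub, map_smul, hS, hS, hc,
    sub_mul, ← Algebra.smul_def, mul_smul_comm]
  module

theorem exists_pow_eq_mul_pow [CompleteSpace A] (h : SlicedProduct i j) {a : A} {b : B} {μ ν : ℂ}
    (hμ : μ ≠ 0) (ha : ¬ ∃ c, c * (a - algebraMap ℂ A μ) = 1) {m n : ℕ} {w : E}
    (hw : (i a * j b - algebraMap ℂ E (μ * ν)) ^ m
      = w * (i a * j b - algebraMap ℂ E (μ * ν)) ^ n) :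
    ∃ c, (b - algebraMap ℂ B ν) ^ m = c * (b - algebraMap ℂ B ν) ^ n := by
  obtain ⟨φ, h1, hφ⟩ := exists_dual_mul_right_eq_zero ha
  obtain ⟨S, hS⟩ := h.slice_left φ
  have hpow : ∀ (k : ℕ) u, S (u * (i a * j b - algebraMap ℂ E (μ * ν)) ^ k)
      = μ ^ k • (S u * (b - algebraMap ℂ B ν) ^ k) := by
    intro k
    induction k with
    | zero => simp
    | succ k ih =>
      intro u
      rw [pow_succ, ← mul_assoc, h.slice_mul_sub hS hφ, ih, smul_mul_assoc, smul_smul, mul_assoc,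
        ← pow_succ, ← pow_succ']
  have hS1 : S 1 = 1 := by simpa [h1] using hS 1 1
  have := congrArg S hw
  rw [hpow, ← one_mul (_ ^ m), hpow, hS1, one_mul] at this
  refine ⟨(μ ^ m)⁻¹ • μ ^ n • S w, ?_⟩
  rw [smul_mul_assoc, smul_mul_assoc, ← this, inv_smul_smul₀ (pow_ne_zero m hμ)]

theorem exists_pow_eq_pow_mul [CompleteSpace A] (h : SlicedProduct i j) {a : A} {b : B} {μ ν : ℂ}
    (hμ : μ ≠ 0) (ha : ¬ ∃ c, (a - algebraMap ℂ A μ) * c = 1) {m n : ℕ} {w : E}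
    (hw : (i a * j b - algebraMap ℂ E (μ * ν)) ^ m
      = (i a * j b - algebraMap ℂ E (μ * ν)) ^ n * w) :
    ∃ c, (b - algebraMap ℂ B ν) ^ m = (b - algebraMap ℂ B ν) ^ n * c := by
  obtain ⟨φ, h1, hφ⟩ := exists_dual_mul_left_eq_zero ha
  obtain ⟨S, hS⟩ := h.slice_left φ
  have hpow : ∀ (k : ℕ) u, S ((i a * j b - algebraMap ℂ E (μ * ν)) ^ k * u)
      = μ ^ k • ((b - algebraMap ℂ B ν) ^ k * S u) := by
    intro k
    induction k with
    | zero => simp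
    | succ k ih =>
      intro u
      rw [pow_succ', mul_assoc, h.slice_sub_mul hS hφ, ih, mul_smul_comm, smul_smul, ← mul_assoc,
        ← pow_succ', ← pow_succ']
  have hS1 : S 1 = 1 := by simpa [h1] using hS 1 1
  have := congrArg S hw
  rw [hpow, ← mul_one (_ ^ m), hpow, hS1, mul_one] at this
  refine ⟨(μ ^ m)⁻¹ • μ ^ n • S w, ?_⟩
  rw [mul_smul_comm, mul_smul_comm, ← this, inv_smul_smul₀ (pow_ne_zero m hμ)]

/-- Exponents `0` and `1` in the transported relations are one-sided invertibility, and the two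
one-sided inverses of `b - ν` coincide. -/
theorem isUnit_sub_of_notMem_interior [CompleteSpace A] (h : SlicedProduct i j) {a : A} {b : B}
    {μ ν : ℂ} (hμ0 : μ ≠ 0) (hμ : μ ∈ spectrum ℂ a) (hμ' : μ ∉ interior (spectrum ℂ a))
    (hu : IsUnit (i a * j b - algebraMap ℂ E (μ * ν))) : IsUnit (b - algebraMap ℂ B ν) := by
  obtain ⟨h1, h2⟩ := not_exists_inverse_of_mem_frontier_spectrum hμ hμ'
  obtain ⟨u, hu⟩ := hu
  obtain ⟨c, hc⟩ := h.exists_pow_eq_mul_pow (b := b) (ν := ν) hμ0 h1 (m := 0) (n := 1)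
    (w := ↑u⁻¹) (by rw [← hu]; simp)
  obtain ⟨d, hd⟩ := h.exists_pow_eq_pow_mul (b := b) (ν := ν) hμ0 h2 (m := 0) (n := 1)
    (w := ↑u⁻¹) (by rw [← hu]; simp)
  rw [pow_zero, pow_one] at hc hd
  have : c = d := left_inv_eq_right_inv hc.symm hd.symm
  exact ⟨⟨_, d, hd.symm, by rw [← this, hc]⟩, rfl⟩

theorem mul_mem_spectrum [CompleteSpace A] [CompleteSpace B] (h : SlicedProduct i j) {a : A}
    {b : B} {μ ν : ℂ} (hμν : μ * ν ≠ 0) (hμ : μ ∈ spectrum ℂ a) (hν : ν ∈ spectrum ℂ b) :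
    μ * ν ∈ spectrum ℂ (i a * j b) := by
  by_contra hn
  have hu : IsUnit (i a * j b - algebraMap ℂ E (μ * ν)) := isUnit_sub_algebraMap_iff.2 hn
  have hμ0 := left_ne_zero_of_mul hμν
  have hν0 := right_ne_zero_of_mul hμν
  -- The pair `(μ, ν)` moves along the curve of constant product, parametrized by `exp` so that the
  -- parameter space `ℂ` is connected. As `μ ν` is assumed outside the spectrum of `a ⊗ b`, both
  -- members of a spectral pair must be interior points, so `K` is open as well as closed.
  set K : Set ℂ := {s | Complex.exp s * μ ∈ spectrum ℂ a ∧ Complex.exp (-s) * ν ∈ spectrum ℂ b}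
  have hc1 : Continuous fun s : ℂ => Complex.exp s * μ := by fun_prop
  have hc2 : Continuous fun s : ℂ => Complex.exp (-s) * ν := by fun_prop
  have hclosed : IsClosed K :=
    ((spectrum.isClosed a).preimage hc1).inter ((spectrum.isClosed b).preimage hc2)
  have hprod : ∀ s, (Complex.exp s * μ) * (Complex.exp (-s) * ν) = μ * ν := by
    intro s
    rw [mul_mul_mul_comm, ← Complex.exp_add, add_neg_cancel, Complex.exp_zero, one_mul]
  have hK : K = {s | Complex.exp s * μ ∈ interior (spectrum ℂ a) ∧
      Complex.exp (-s) * ν ∈ interior (spectrum ℂ b)} := by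
    ext s
    refine ⟨fun ⟨h1, h2⟩ => ⟨?_, ?_⟩, fun ⟨h1, h2⟩ => ⟨interior_subset h1, interior_subset h2⟩⟩
    · by_contra hi
      refine isUnit_sub_algebraMap_iff.1 (h.isUnit_sub_of_notMem_interior (b := b)
        (ν := Complex.exp (-s) * ν) (mul_ne_zero (Complex.exp_ne_zero s) hμ0) h1 hi ?_) h2
      rwa [hprod]
    · by_contra hi
      refine isUnit_sub_algebraMap_iff.1 (h.symm.isUnit_sub_of_notMem_interior (b := a)
        (ν := Complex.exp s * μ) (mul_ne_zero (Complex.exp_ne_zero _) hν0) h2 hi ?_) h1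
      rwa [mul_comm (_ * ν), hprod, ← (h.commute a b).eq]
  have hopen : IsOpen K := by
    rw [hK]
    exact (isOpen_interior.preimage hc1).inter (isOpen_interior.preimage hc2)
  have huniv : K = Set.univ := IsClopen.eq_univ ⟨hclosed, hopen⟩ ⟨0, by simpa [K] using ⟨hμ, hν⟩⟩
  -- `K = ℂ` would put every nonzero number into the bounded set `σ(a)`.
  obtain ⟨C, hC⟩ := (spectrum.isCompact (𝕜 := ℂ) a).exists_bound_of_continuousOn continuousOn_id
  have hz : ((|C| + 1 : ℝ) : ℂ) ≠ 0 := by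
    rw [Complex.ofReal_ne_zero]; positivity
  have hs : Complex.log (((|C| + 1 : ℝ) : ℂ) / μ) ∈ K := huniv ▸ Set.mem_univ _
  have := hC _ hs.1
  rw [id, Complex.exp_log (div_ne_zero hz hμ0), div_mul_cancel₀ _ hμ0, Complex.norm_real,
    Real.norm_of_nonneg (by positivity)] at this
  linarith [le_abs_self C]

/-- If `a ⊗ b - μ ν` is Drazin invertible, with `μ ν ≠ 0` and `μ` in the spectrum of `a`, then
`b - ν` is Drazin invertible. -/
theorem isDrazinInvertible_sub [CompleteSpace A] [CompleteSpace B] [CompleteSpace E]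
    (h : SlicedProduct i j) {a : A} {b : B} {μ ν : ℂ} (hμν : μ * ν ≠ 0) (hμ : μ ∈ spectrum ℂ a)
    (hD : IsDrazinInvertible (i a * j b - algebraMap ℂ E (μ * ν))) :
    IsDrazinInvertible (b - algebraMap ℂ B ν) := by
  by_cases hν : ν ∈ spectrum ℂ b
  swap
  · exact (isUnit_sub_algebraMap_iff.2 hν).isDrazinInvertible
  have hμ0 := left_ne_zero_of_mul hμν
  have hν0 := right_ne_zero_of_mul hμν
  have hint : μ ∉ interior (spectrum ℂ a) := by
    intro hi
    have hiso := hD.eventually_notMem_spectrum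
    rw [eventually_nhdsWithin_iff] at hiso
    have ht : Tendsto (fun z : ℂ => z * ν) (𝓝 μ) (𝓝 (μ * ν)) :=
      (continuous_mul_const ν).tendsto μ
    have hev : ∀ᶠ z in 𝓝 μ, z = μ := by
      filter_upwards [ht.eventually hiso, mem_interior_iff_mem_nhds.1 hi,
        isOpen_ne.mem_nhds hμ0] with z hz hzs hz0
      by_contra hzμ
      exact hz (fun he => hzμ (mul_right_cancel₀ hν0 he))
        (h.mul_mem_spectrum (mul_ne_zero hz0 hν0) hzs hν)
    have : (𝓝[≠] μ).NeBot := inferInstance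
    obtain ⟨z, hz, hz'⟩ := ((hev.filter_mono nhdsWithin_le_nhds).and
      (self_mem_nhdsWithin : {μ}ᶜ ∈ 𝓝[≠] μ)).exists
    exact hz' hz
  obtain ⟨h1, h2⟩ := not_exists_inverse_of_mem_frontier_spectrum hμ hint
  obtain ⟨y, m, -, hy1, hy2⟩ := hD.exists_pow_eq
  obtain ⟨c, hc⟩ := h.exists_pow_eq_pow_mul hμ0 h2 hy1
  obtain ⟨d, hd⟩ := h.exists_pow_eq_mul_pow hμ0 h1 hy2
  exact .of_pow_eq hc hd

/-- As `b ^ m ≠ 0`, some functional `ψ` has `ψ (b ^ m) = 1`. Its slice map is an `A`-bimodule map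
sending `(a ⊗ b) ^ m` to `a ^ m`. Non-nilpotency is needed because `m` comes from `a ⊗ b`. -/
theorem isDrazinInvertible_left (h : SlicedProduct i j) {a : A} {b : B} (hb : ¬ IsNilpotent b)
    (hD : IsDrazinInvertible (i a * j b)) : IsDrazinInvertible a := by
  obtain ⟨y, m, -, hy1, hy2⟩ := hD.exists_pow_eq
  have hbm : b ^ m ≠ 0 := fun h0 => hb ⟨m, h0⟩
  obtain ⟨ψ, hψ⟩ := SeparatingDual.exists_eq_one (R := ℂ) hbm
  obtain ⟨S, hS⟩ := h.slice_right ψ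
  have hl : ∀ c u, S (i c * u) = c * S u := fun c u =>
    h.ext_clm (S := S.comp (ContinuousLinearMap.mul ℂ E (i c)))
      (T := (ContinuousLinearMap.mul ℂ A c).comp S) (fun a' b' => by
        simp only [ContinuousLinearMap.comp_apply, ContinuousLinearMap.mul_apply']
        rw [← mul_assoc, ← map_mul, hS, hS, mul_smul_comm]) u
  have hr : ∀ c u, S (u * i c) = S u * c := fun c u =>
    h.ext_clm (S := S.comp ((ContinuousLinearMap.mul ℂ E).flip (i c)))
      (T := ((ContinuousLinearMap.mul ℂ A).flip c).comp S) (fun a' b' => by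
        simp only [ContinuousLinearMap.comp_apply, ContinuousLinearMap.mul_apply',
          ContinuousLinearMap.flip_apply]
        rw [mul_assoc, ← (h.commute c b').eq, ← mul_assoc, ← map_mul, hS, hS, smul_mul_assoc]) u
  have hpow : ∀ k, (i a * j b) ^ k = i (a ^ k) * j (b ^ k) := fun k => by
    rw [(h.commute a b).mul_pow, map_pow, map_pow]
  have hm : S ((i a * j b) ^ m) = a ^ m := by rw [hpow, hS, hψ, one_smul]
  refine .of_pow_eq (m := m) (c := S (j (b ^ (m + 1)) * y)) (d := S (y * j (b ^ (m + 1)))) ?_ ?_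
  · rw [← hl, ← mul_assoc, ← hpow, ← hy1, hm]
  · rw [← hr, mul_assoc, ← (h.commute _ _).eq, ← hpow, ← hy2, hm]

end SlicedProduct

end SlicedProduct

/-! ### Drazin invertibility of `a ⊗ b - l` from its factors. -/

section UpperInclusion

open Filter Topology

/-- In a commutative Banach algebra, idempotents that split off the spectral points `(μ, ν)` of
`(x, y)` with `μ ν = l` exhibit `x y - l` as Drazin invertible. -/
theorem isDrazinInvertible_mul_sub_of_idempotents {C : Type*} [NormedCommRing C]
    [NormedAlgebra ℂ C] [CompleteSpace C] {x y : C} {l : ℂ} {t : Finset (ℂ × ℂ)}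
    (ht : ∀ p ∈ t, p.1 * p.2 = l) {e f : ℂ × ℂ → C}
    (he : ∀ p ∈ t, e p * e p = e p ∧ IsUnit (x - algebraMap ℂ C p.1 + e p) ∧
      IsNilpotent ((x - algebraMap ℂ C p.1) * e p))
    (hf : ∀ p ∈ t, f p * f p = f p ∧ IsUnit (y - algebraMap ℂ C p.2 + f p) ∧
      IsNilpotent ((y - algebraMap ℂ C p.2) * f p))
    (hxy : ∀ χ : C →ₐ[ℂ] ℂ, χ x * χ y = l → (χ x, χ y) ∈ t) :
    IsDrazinInvertible (x * y - algebraMap ℂ C l) := by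
  -- On characters, a spectral idempotent of `u - μ` is the indicator of `χ u = μ`.
  have hval : ∀ (χ : C →ₐ[ℂ] ℂ) (u v : C) (μ : ℂ), (v * v = v ∧ IsUnit (u - algebraMap ℂ C μ + v) ∧
      IsNilpotent ((u - algebraMap ℂ C μ) * v)) → χ v = if χ u = μ then 1 else 0 := by
    rintro χ u v μ ⟨h1, h2, h3⟩
    have h1' := congrArg χ h1
    have h2' := (h2.map χ).ne_zero
    have h3' := (h3.map χ).eq_zero
    simp only [map_mul, map_add, map_sub, AlgHom.commutes, Algebra.algebraMap_self,
      RingHom.id_apply] at h1' h2' h3'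
    split_ifs with h
    · rw [h, sub_self, zero_add] at h2'
      exact mul_right_cancel₀ h2' (h1'.trans (one_mul _).symm)
    · exact (mul_eq_zero.1 h3').resolve_left (sub_ne_zero.2 h)
  -- Nilpotency comes from `x y - μ ν = y (x - μ) + μ (y - ν)`. Invertibility is tested on
  -- characters, where the sum is the indicator of `χ x χ y = l`.
  refine .of_isUnit_add (p := ∑ p ∈ t, e p * f p) (Commute.all _ _) ?_ ?_
  · rw [← mem_nilradical, Finset.mul_sum]
    refine Ideal.sum_mem _ fun p hp => ?_
    have : (x * y - algebraMap ℂ C l) * (e p * f p)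
        = (y * f p) * ((x - algebraMap ℂ C p.1) * e p)
          + (algebraMap ℂ C p.1 * e p) * ((y - algebraMap ℂ C p.2) * f p) := by
      rw [← ht p hp, map_mul]; ring
    rw [this]
    exact Ideal.add_mem _ (Ideal.mul_mem_left _ _ (he p hp).2.2)
      (Ideal.mul_mem_left _ _ (hf p hp).2.2)
  · by_contra hu
    obtain ⟨χ, hχ⟩ := WeakDual.CharacterSpace.exists_apply_eq_zero hu
    have hχ' : WeakDual.CharacterSpace.toAlgHom χ
        (x * y - algebraMap ℂ C l + ∑ p ∈ t, e p * f p) = 0 := hχ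
    generalize WeakDual.CharacterSpace.toAlgHom χ = χ at hχ'
    have hsum : χ (∑ p ∈ t, e p * f p) = if (χ x, χ y) ∈ t then 1 else 0 := by
      rw [map_sum, ← Finset.sum_ite_eq t (χ x, χ y) (fun _ => (1 : ℂ))]
      refine Finset.sum_congr rfl fun p hp => ?_
      rw [map_mul, hval χ x _ _ (he p hp), hval χ y _ _ (hf p hp), ite_zero_mul_ite_zero, one_mul]
      simp only [Prod.ext_iff]
    rw [map_add, hsum, map_sub, map_mul, AlgHom.commutes, Algebra.algebraMap_self,
      RingHom.id_apply] at hχ'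
    split_ifs at hχ' with h
    · rw [ht _ h, sub_self, zero_add] at hχ'
      exact one_ne_zero hχ'
    · rw [add_zero, sub_eq_zero] at hχ'
      exact h (hxy χ hχ')

/-- The set is compact and discrete: `μ` is isolated in `K`, and `ν` is determined by `μ` because `l
≠ 0`. -/
theorem finite_setOf_mul_eq {K L : Set ℂ} (hK : IsCompact K) (hL : IsCompact L) {l : ℂ}
    (hl : l ≠ 0) (hiso : ∀ μ ∈ K, ∀ ν ∈ L, μ * ν = l → ∀ᶠ z in 𝓝[≠] μ, z ∉ K) :
    {p : ℂ × ℂ | p.1 ∈ K ∧ p.2 ∈ L ∧ p.1 * p.2 = l}.Finite := by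
  set G := {p : ℂ × ℂ | p.1 ∈ K ∧ p.2 ∈ L ∧ p.1 * p.2 = l}
  have hG : IsCompact G := by
    have : G = (K ×ˢ L) ∩ {p | p.1 * p.2 = l} := by
      ext p; simp [G, and_assoc]
    rw [this]
    exact (hK.prod hL).inter_right (isClosed_eq (by fun_prop) continuous_const)
  have hU : ∀ p ∈ G, ∃ U ∈ 𝓝 p, ∀ q ∈ U, q ∈ G → q = p := by
    rintro p ⟨hp1, hp2, hp⟩
    have h := hiso _ hp1 _ hp2 hp
    rw [eventually_nhdsWithin_iff] at h
    refine ⟨_, (continuous_fst.tendsto p).eventually h, fun q hq hqG => ?_⟩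
    have h1 : q.1 = p.1 := by
      by_contra hne
      exact hq hne hqG.1
    have h2 : p.1 * q.2 = p.1 * p.2 := by rw [hp, ← h1, hqG.2.2]
    exact Prod.ext h1 (mul_left_cancel₀ (left_ne_zero_of_mul (hp ▸ hl)) h2)
  choose! U hU hUG using hU
  obtain ⟨t, htG, ht⟩ := hG.elim_nhds_subcover U hU
  refine t.finite_toSet.subset fun q hq => ?_
  obtain ⟨p, hp, hqp⟩ := Set.mem_iUnion₂.1 (ht hq)
  rw [hUG p (htG p hp) q hqp hq]
  exact hp

variable {A B E : Type*} [NormedRing A] [NormedAlgebra ℂ A] [CompleteSpace A]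
  [NormedRing B] [NormedAlgebra ℂ B] [CompleteSpace B]
  [NormedRing E] [NormedAlgebra ℂ E] [CompleteSpace E]

theorem isDrazinInvertible_mul_sub_of_commute {i : A →ₐ[ℂ] E} {j : B →ₐ[ℂ] E}
    (hij : ∀ a b, Commute (i a) (j b)) {a : A} {b : B} {l : ℂ} (hl : l ≠ 0)
    (h : ∀ μ ∈ spectrum ℂ a, ∀ ν ∈ spectrum ℂ b, μ * ν = l →
      IsDrazinInvertible (a - algebraMap ℂ A μ) ∧ IsDrazinInvertible (b - algebraMap ℂ B ν)) :
    IsDrazinInvertible (i a * j b - algebraMap ℂ E l) := by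
  have hfin := finite_setOf_mul_eq (spectrum.isCompact a) (spectrum.isCompact b) hl
    fun μ hμ ν hν hμν => (h μ hμ ν hν hμν).1.eventually_notMem_spectrum
  set s : Set E := {i a, j b}
  -- The bicommutant is commutative, closed and closed under inverses, and it contains the spectral
  -- idempotents of its Drazin invertible elements.
  set C : Subalgebra ℂ E := Subalgebra.centralizer ℂ (Subalgebra.centralizer ℂ s : Set E) with hC
  have hsC : ∀ z ∈ C, ∀ w, (∀ g ∈ s, g * w = w * g) → w * z = z * w := fun z hz w hw =>
    (Subalgebra.mem_centralizer_iff ℂ).1 hz w ((Subalgebra.mem_centralizer_iff ℂ).2 hw)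
  have hss : ∀ w, (∀ g ∈ s, g * w = w * g) ↔ Commute w (i a) ∧ Commute w (j b) := fun w => by
    simp only [s, Set.mem_insert_iff, Set.mem_singleton_iff, forall_eq_or_imp, forall_eq]
    exact and_congr ⟨Eq.symm, Eq.symm⟩ ⟨Eq.symm, Eq.symm⟩
  have hmem : ∀ z, (∀ w, Commute w (i a) → Commute w (j b) → Commute w z) → z ∈ C := fun z hz =>
    (Subalgebra.mem_centralizer_iff ℂ).2 fun w hw =>
      let hw' := (hss w).1 ((Subalgebra.mem_centralizer_iff ℂ).1 hw)
      hz w hw'.1 hw'.2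
  have hcom : ∀ z ∈ C, ∀ w, Commute w (i a) → Commute w (j b) → Commute w z := fun z hz w h1 h2 =>
    hsC z hz w ((hss w).2 ⟨h1, h2⟩)
  have hCc : ∀ z ∈ C, ∀ w ∈ C, z * w = w * z := fun z hz w hw =>
    (hcom w hw z (hcom z hz _ (Commute.refl _) (hij a b)).symm
      (hcom z hz _ (hij a b).symm (Commute.refl _)).symm).eq
  have hclosed : IsClosed (C : Set E) := Set.isClosed_centralizer _
  let : NormedCommRing C :=
    { (inferInstance : NormedRing C) with mul_comm := fun z w => Subtype.ext (hCc z z.2 w w.2) }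
  have : CompleteSpace C := hclosed.completeSpace_coe
  have hunit : ∀ z : C, IsUnit (z : E) → IsUnit z := by
    rintro z ⟨u, hu⟩
    have hui : (↑u⁻¹ : E) ∈ C := hmem _ fun w h1 h2 => by
      refine Commute.units_inv_right ?_
      rw [hu]
      exact hcom z z.2 w h1 h2
    exact IsUnit.of_mul_eq_one ⟨↑u⁻¹, hui⟩ (Subtype.ext (by
      change (z : E) * ↑u⁻¹ = 1
      rw [← hu, Units.mul_inv]))
  set x : C := ⟨i a, hmem _ fun w h1 _ => h1⟩ with hx
  set y : C := ⟨j b, hmem _ fun w _ h2 => h2⟩ with hy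
  have hspec : ∀ (χ : C →ₐ[ℂ] ℂ), χ x ∈ spectrum ℂ a ∧ χ y ∈ spectrum ℂ b := by
    intro χ
    have hz : ∀ z : C, ¬ IsUnit (z - algebraMap ℂ C (χ z)) := fun z hz => by
      have := (hz.map χ).ne_zero
      rw [map_sub, AlgHom.commutes] at this
      exact this (sub_self _)
    constructor
    · by_contra hn
      refine hz x (hunit _ ?_)
      have := (isUnit_sub_algebraMap_iff.2 hn).map i
      rwa [map_sub, AlgHom.commutes] at this
    · by_contra hn
      refine hz y (hunit _ ?_)
      have := (isUnit_sub_algebraMap_iff.2 hn).map j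
      rwa [map_sub, AlgHom.commutes] at this
  have hproj : ∀ (z : C) (μ : ℂ), IsDrazinInvertible ((z : E) - algebraMap ℂ E μ) →
      ∃ e : C, e * e = e ∧ IsUnit (z - algebraMap ℂ C μ + e) ∧
        IsNilpotent ((z - algebraMap ℂ C μ) * e) := by
    intro z μ hD
    obtain ⟨e, h1, h2, h3, k, h4⟩ := hD.exists_spectral_idempotent
    have he : e ∈ C := hmem _ fun w hw1 hw2 =>
      h2 w ((hcom z z.2 w hw1 hw2).sub_right (Algebra.commutes μ w).symm)
    exact ⟨⟨e, he⟩, Subtype.ext h1, hunit _ h3, k, Subtype.ext h4⟩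
  have hex : ∀ p : ℂ × ℂ, ∃ e : C, p ∈ hfin.toFinset → e * e = e ∧
      IsUnit (x - algebraMap ℂ C p.1 + e) ∧ IsNilpotent ((x - algebraMap ℂ C p.1) * e) := by
    intro p
    by_cases hp : p ∈ hfin.toFinset
    · obtain ⟨hp1, hp2, hp⟩ := hfin.mem_toFinset.1 hp
      have := (h _ hp1 _ hp2 hp).1.map (i : A →+* E)
      rw [RingHom.coe_coe, map_sub, AlgHom.commutes] at this
      exact (hproj x _ this).imp fun _ he _ => he
    · exact ⟨0, fun hp' => absurd hp' hp⟩
  have hey : ∀ p : ℂ × ℂ, ∃ f : C, p ∈ hfin.toFinset → f * f = f ∧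
      IsUnit (y - algebraMap ℂ C p.2 + f) ∧ IsNilpotent ((y - algebraMap ℂ C p.2) * f) := by
    intro p
    by_cases hp : p ∈ hfin.toFinset
    · obtain ⟨hp1, hp2, hp⟩ := hfin.mem_toFinset.1 hp
      have := (h _ hp1 _ hp2 hp).2.map (j : B →+* E)
      rw [RingHom.coe_coe, map_sub, AlgHom.commutes] at this
      exact (hproj y _ this).imp fun _ hf _ => hf
    · exact ⟨0, fun hp' => absurd hp' hp⟩
  choose e he using hex
  choose f hf using hey
  have key := isDrazinInvertible_mul_sub_of_idempotents
    (fun p hp => (hfin.mem_toFinset.1 hp).2.2) he hf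
    (fun χ hχ => hfin.mem_toFinset.2 ⟨(hspec χ).1, (hspec χ).2, hχ⟩)
  exact key.map (C.val : C →+* E)

end UpperInclusion

/-! ### Slice maps on the completed tensor product. -/

section Completion

open UniformSpace

namespace UniformCrossnorm

variable {A B : Type*} [NormedRing A] [NormedAlgebra ℂ A] [NormedRing B] [NormedAlgebra ℂ B]
  (α : UniformCrossnorm A B)

/-- The inclusion of `A ⊗ B` into its completion. -/
noncomputable def toCompletion : A ⊗[ℂ] B →ₐ[ℂ] α.Completion :=
  AlgHom.comp { Completion.coeRingHom (α := α.Normed) with commutes' := fun _ => rfl }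
    (α.toNormed : A ⊗[ℂ] B →ₐ[ℂ] α.Normed)

theorem toCompletion_tmul (a : A) (b : B) :
    α.toCompletion (Algebra.TensorProduct.includeLeft (S := ℂ) a) *
      α.toCompletion (Algebra.TensorProduct.includeRight b) = α.tmul a b := by
  rw [← map_mul, Algebra.TensorProduct.includeLeft_apply, Algebra.TensorProduct.includeRight_apply,
    Algebra.TensorProduct.tmul_mul_tmul, mul_one, one_mul]
  rfl

theorem exists_extension {F : Type*} [NormedAddCommGroup F] [NormedSpace ℂ F] [CompleteSpace F]
    (L : A ⊗[ℂ] B →ₗ[ℂ] F) {K : ℝ} (hL : ∀ u, ‖L u‖ ≤ K * α.toAlgebraNorm u) :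
    ∃ S : α.Completion →L[ℂ] F, ∀ u, S (α.toCompletion u) = L u := by
  let L' : α.Normed →L[ℂ] F :=
    (L.comp (α.toNormed.symm : α.Normed →ₗ[ℂ] A ⊗[ℂ] B)).mkContinuous K hL
  let e : α.Normed →L[ℂ] α.Completion := Completion.toComplL
  exact ⟨L'.extend e, fun u => L'.extend_eq (e := e) Completion.denseRange_coe
    (Completion.isUniformInducing_coe _) (α.toNormed u)⟩

/-- Uniformity of the norm is applied to the rank-one operator `T = φ(·) 1`: since `(T ⊗ id) u = 1 ⊗
L u`, the crossnorm property bounds `‖1‖ ‖L u‖`. The factor `‖1‖⁻¹` remains because `‖1‖ = 1` is not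
assumed. -/
theorem exists_slice_left [Nontrivial A] [CompleteSpace B] (φ : A →L[ℂ] ℂ) :
    ∃ S : α.Completion →L[ℂ] B, ∀ a b, S (α.tmul a b) = φ a • b := by
  let L : A ⊗[ℂ] B →ₗ[ℂ] B :=
    (TensorProduct.lid ℂ B).toLinearMap ∘ₗ TensorProduct.map (φ : A →ₗ[ℂ] ℂ) LinearMap.id
  let T : A →L[ℂ] A := φ.smulRight 1
  have hT : ∀ u, TensorProduct.map (T : A →ₗ[ℂ] A)
      (ContinuousLinearMap.id ℂ B : B →ₗ[ℂ] B) u = 1 ⊗ₜ[ℂ] L u := by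
    intro u
    induction u with
    | zero => simp
    | add u v hu hv => rw [map_add, hu, hv, map_add, TensorProduct.tmul_add]
    | tmul a b => simp [L, T, TensorProduct.smul_tmul]
  obtain ⟨S, hS⟩ := α.exists_extension L
    (K := ‖(1 : A)‖⁻¹ * (‖T‖ * ‖ContinuousLinearMap.id ℂ B‖)) (fun u => by
      have := α.map_le' T (ContinuousLinearMap.id ℂ B) u
      rw [hT, α.tmul_eq'] at this
      rw [mul_assoc, le_inv_mul_iff₀ (norm_pos_iff.2 one_ne_zero)]
      exact this)
  exact ⟨S, fun a b => (hS (a ⊗ₜ b)).trans (by simp [L])⟩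

theorem exists_slice_right [Nontrivial B] [CompleteSpace A] (ψ : B →L[ℂ] ℂ) :
    ∃ S : α.Completion →L[ℂ] A, ∀ a b, S (α.tmul a b) = ψ b • a := by
  let L : A ⊗[ℂ] B →ₗ[ℂ] A :=
    (TensorProduct.rid ℂ A).toLinearMap ∘ₗ TensorProduct.map LinearMap.id (ψ : B →ₗ[ℂ] ℂ)
  let T : B →L[ℂ] B := ψ.smulRight 1
  have hT : ∀ u, TensorProduct.map (ContinuousLinearMap.id ℂ A : A →ₗ[ℂ] A)
      (T : B →ₗ[ℂ] B) u = L u ⊗ₜ[ℂ] 1 := by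
    intro u
    induction u with
    | zero => simp
    | add u v hu hv => rw [map_add, hu, hv, map_add, TensorProduct.add_tmul]
    | tmul a b => simp [L, T, TensorProduct.smul_tmul]
  obtain ⟨S, hS⟩ := α.exists_extension L
    (K := ‖(1 : B)‖⁻¹ * (‖ContinuousLinearMap.id ℂ A‖ * ‖T‖)) (fun u => by
      have := α.map_le' (ContinuousLinearMap.id ℂ A) T u
      rw [hT, α.tmul_eq'] at this
      rw [mul_assoc, le_inv_mul_iff₀ (norm_pos_iff.2 one_ne_zero), mul_comm]
      exact this)
  exact ⟨S, fun a b => (hS (a ⊗ₜ b)).trans (by simp [L])⟩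

theorem slicedProduct [Nontrivial A] [CompleteSpace A] [Nontrivial B] [CompleteSpace B] :
    SlicedProduct (α.toCompletion.comp (Algebra.TensorProduct.includeLeft (S := ℂ)))
      (α.toCompletion.comp Algebra.TensorProduct.includeRight) where
  commute a b := by
    refine Commute.map (f := α.toCompletion) ?_
    simp [Commute, SemiconjBy]
  dense := by
    refine (Completion.denseRange_coe (α := α.Normed)).mono ?_
    rintro _ ⟨u, rfl⟩
    change α.toCompletion u ∈ _
    generalize (show A ⊗[ℂ] B from u) = u
    induction u with
    | zero => rw [map_zero]; exact Submodule.zero_mem _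
    | add u v hu hv => rw [map_add]; exact Submodule.add_mem _ hu hv
    | tmul a b => exact Submodule.subset_span ⟨a, b, (α.toCompletion_tmul a b).symm⟩
  slice_left φ := (α.exists_slice_left φ).imp fun S hS a b => by
    rw [← hS, ← toCompletion_tmul]; rfl
  slice_right ψ := (α.exists_slice_right ψ).imp fun S hS a b => by
    rw [← hS, ← toCompletion_tmul]; rfl

end UniformCrossnorm

end Completion

/-! ### Elementary facts on the Drazin spectrum, and the point `0`. -/

section DrazinSpectrum

variable {R : Type*} [Ring R] [Algebra ℂ R]

theorem zero_mem_drazinSpectrum_iff {a : R} : 0 ∈ drazinSpectrum a ↔ ¬ IsDrazinInvertible a := by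
  simp [drazinSpectrum]

theorem zero_mem_drazinResolventSet_iff {a : R} :
    0 ∈ drazinResolventSet a ↔ IsDrazinInvertible a := by
  simp [drazinResolventSet]

theorem drazinSpectrum_subset_spectrum (a : R) : drazinSpectrum a ⊆ spectrum ℂ a := by
  intro z hz
  by_contra hn
  exact hz (isUnit_sub_algebraMap_iff.2 hn).isDrazinInvertible

/-- For nilpotent `a`, the element `a - z` is nilpotent if `z = 0` and otherwise a unit plus a
commuting nilpotent. -/
theorem not_isNilpotent_of_nonempty_drazinSpectrum {a : R} (h : (drazinSpectrum a).Nonempty) :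
    ¬ IsNilpotent a := by
  rintro hn
  obtain ⟨z, hz⟩ := h
  refine hz ?_
  by_cases hz0 : z = 0
  · rw [hz0, map_zero, sub_zero]
    exact hn.isDrazinInvertible
  · have hu : IsUnit (algebraMap ℂ R z) := (IsUnit.mk0 z hz0).map _
    refine IsUnit.isDrazinInvertible ?_
    rw [← neg_sub, IsUnit.neg_iff]
    obtain ⟨u, hu⟩ := hu
    rw [← hu, sub_eq_add_neg]
    refine hn.neg.isUnit_add_left_of_commute u.isUnit (Commute.neg_left ?_)
    rw [hu]
    exact (Algebra.commutes z a).symm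

theorem nontrivial_of_nonempty_drazinSpectrum {a : R} (h : (drazinSpectrum a).Nonempty) :
    Nontrivial R := by
  by_contra hR
  rw [not_nontrivial_iff_subsingleton] at hR
  exact not_isNilpotent_of_nonempty_drazinSpectrum h ⟨1, Subsingleton.elim _ _⟩

theorem zero_mem_mul_drazinSpectrum_union_iff {S : Type*} [Ring S] [Algebra ℂ S] {a : R} {b : S}
    (ha : (drazinSpectrum a).Nonempty)
    (hb : (drazinSpectrum b).Nonempty) :
    (0 : ℂ) ∈ spectrum ℂ a * drazinSpectrum b ∪ drazinSpectrum a * spectrum ℂ b ↔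
      ¬ (IsUnit a ∧ IsUnit b) := by
  rw [not_and_or, ← spectrum.zero_mem_iff ℂ, ← spectrum.zero_mem_iff ℂ]
  constructor
  · rintro (⟨μ, hμ, ν, hν, h0⟩ | ⟨μ, hμ, ν, hν, h0⟩)
    · rcases mul_eq_zero.1 h0 with rfl | rfl
      exacts [Or.inl hμ, Or.inr (drazinSpectrum_subset_spectrum b hν)]
    · rcases mul_eq_zero.1 h0 with rfl | rfl
      exacts [Or.inl (drazinSpectrum_subset_spectrum a hμ), Or.inr hν]
  · rintro (h0 | h0)
    · obtain ⟨ν, hν⟩ := hb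
      exact Or.inl ⟨0, h0, ν, hν, zero_mul ν⟩
    · obtain ⟨μ, hμ⟩ := ha
      exact Or.inr ⟨μ, hμ, 0, h0, mul_zero μ⟩

end DrazinSpectrum

/-! ### Comparison of the two sets and the equivalences. -/

namespace SlicedProduct

variable {A B E : Type*} [NormedRing A] [NormedAlgebra ℂ A] [CompleteSpace A]
  [NormedRing B] [NormedAlgebra ℂ B] [CompleteSpace B]
  [NormedRing E] [NormedAlgebra ℂ E] [CompleteSpace E] {i : A →ₐ[ℂ] E} {j : B →ₐ[ℂ] E}

theorem mem_drazinSpectrum_iff (h : SlicedProduct i j) (a : A) (b : B) {l : ℂ} (hl : l ≠ 0) :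
    l ∈ spectrum ℂ a * drazinSpectrum b ∪ drazinSpectrum a * spectrum ℂ b ↔
      l ∈ drazinSpectrum (i a * j b) := by
  constructor
  · rintro (⟨μ, hμ, ν, hν, rfl⟩ | ⟨μ, hμ, ν, hν, rfl⟩) hD
    · exact hν (h.isDrazinInvertible_sub hl hμ hD)
    · simp only at hl hD
      rw [mul_comm μ, (h.commute a b).eq] at hD
      exact hμ (h.symm.isDrazinInvertible_sub (mul_comm μ ν ▸ hl) hν hD)
  · intro hD
    by_contra hn
    refine hD (isDrazinInvertible_mul_sub_of_commute h.commute hl fun μ hμ ν hν hμν => ⟨?_, ?_⟩)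
    · by_contra hc
      exact hn (Or.inr ⟨μ, hc, ν, hν, hμν⟩)
    · by_contra hc
      exact hn (Or.inl ⟨μ, hμ, ν, hc, hμν⟩)

omit [CompleteSpace A] [CompleteSpace B] [CompleteSpace E] in
theorem isDrazinInvertible_mul_iff (h : SlicedProduct i j) {a : A} {b : B}
    (ha : (drazinSpectrum a).Nonempty) (hb : (drazinSpectrum b).Nonempty) :
    IsDrazinInvertible (i a * j b) ↔ IsDrazinInvertible a ∧ IsDrazinInvertible b := by
  refine ⟨fun hD => ⟨h.isDrazinInvertible_left
    (not_isNilpotent_of_nonempty_drazinSpectrum hb) hD, h.symm.isDrazinInvertible_left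
    (not_isNilpotent_of_nonempty_drazinSpectrum ha) ?_⟩, fun ⟨h1, h2⟩ =>
      IsDrazinInvertible.map_mul_map (i := (i : A →+* E)) (j := (j : B →+* E)) h.commute h1 h2⟩
  rwa [← (h.commute a b).eq]

theorem tfae (h : SlicedProduct i j) {a : A} {b : B}
    (ha : (drazinSpectrum a).Nonempty) (hb : (drazinSpectrum b).Nonempty) :
    List.TFAE [
      spectrum ℂ a * drazinSpectrum b ∪ drazinSpectrum a * spectrum ℂ b
        = drazinSpectrum (i a * j b),
      (IsUnit a ∧ IsUnit b) ∨ ¬ IsDrazinInvertible (i a * j b),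
      (IsUnit a ∧ IsUnit b) ∨
        (0 : ℂ) ∉ (poleSet a ∩ drazinResolventSet b) ∪ (drazinResolventSet a ∩ poleSet b)] := by
  have h0 := zero_mem_mul_drazinSpectrum_union_iff ha hb
  have hD := h.isDrazinInvertible_mul_iff ha hb
  tfae_have 1 → 2 := by
    intro h1
    rw [h1, zero_mem_drazinSpectrum_iff] at h0
    tauto
  tfae_have 2 → 1 := by
    intro h2
    ext l
    by_cases hl : l = 0
    · rw [hl, h0, zero_mem_drazinSpectrum_iff]
      have : IsUnit a ∧ IsUnit b → IsDrazinInvertible (i a * j b) := fun hu =>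
        hD.2 ⟨hu.1.isDrazinInvertible, hu.2.isDrazinInvertible⟩
      tauto
    · exact h.mem_drazinSpectrum_iff a b hl
  tfae_have 2 ↔ 3 := by
    rw [Set.mem_union, Set.mem_inter_iff, Set.mem_inter_iff, zero_mem_poleSet_iff,
      zero_mem_poleSet_iff, zero_mem_drazinResolventSet_iff, zero_mem_drazinResolventSet_iff, hD]
    tauto
  tfae_finish

end SlicedProduct

theorem theorem4p3 {A B : Type*} [NormedRing A] [NormedAlgebra ℂ A] [CompleteSpace A]
    [NormedRing B] [NormedAlgebra ℂ B] [CompleteSpace B] (α : UniformCrossnorm A B)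
    (a : A) (b : B) (ha : (drazinSpectrum a).Nonempty) (hb : (drazinSpectrum b).Nonempty) :
    List.TFAE [
      spectrum ℂ a * drazinSpectrum b ∪ drazinSpectrum a * spectrum ℂ b
        = drazinSpectrum (α.tmul a b),
      (IsUnit a ∧ IsUnit b) ∨ ¬ IsDrazinInvertible (α.tmul a b),
      (IsUnit a ∧ IsUnit b) ∨
        (0 : ℂ) ∉ (poleSet a ∩ drazinResolventSet b) ∪ (drazinResolventSet a ∩ poleSet b)] := by
  have := nontrivial_of_nonempty_drazinSpectrum ha
  have := nontrivial_of_nonempty_drazinSpectrum hb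
  have h := α.slicedProduct.tfae ha hb
  rw [AlgHom.comp_apply, AlgHom.comp_apply, α.toCompletion_tmul] at h
  exact h
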